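/- Consider $K$ spatially separated parties and an ensemble $\mathcal S=\{|\psi_i\rangle\}_{i=1}^N$ of pure states (unit vectors) of a finite-dimensional $K$-partite quantum system. All protocols are finite-round LOCC protocols: in each step one party performs a generalised measurement with finitely many outcomes (Kraus operators $A_j$ with $\sum_j A_j^\dagger A_j=\mathbb 1$) on its own system and broadcasts the outcome; at the end a classical value depending on all outcomes is announced. * $\mathcal S$ is *locally antidistinguishable* (LSAD) if there is an LOCC protocol announcing an index $j\in\{1,\dots,N\}$ such that, for every $j$, the index $j$ has probability $0$ on the state $|\psi_j\rangle$ and positive probability on at least one state of $\mathcal S$. * For $1\le n\le N$, $\mathcal S$ admits *$(n,m)$-local state antimarking* ($(n,m)$-LSAM) if there is an LOCC protocol which, when a sequence $|\psi_{i_1}\rangle\otimes\cdots\otimes|\psi_{i_n}\rangle$ with pairwise distinct indices is distributed (each party holding its parts of all $n$ states), announces in every run that occurs with non-zero probability a set of at least $m$ index strings of length $n$ with pairwise distinct entries, none of which equals $(i_1,\dots,i_n)$. Let $|\pm\rangle=\tfrac1{\sqrt2}(|0\rangle\pm|1\rangle)$ and let $\mathcal S_{\rm PBR}=\{|00\rangle_{AB},|0+\rangle_{AB},|{+}0\rangle_{AB},|{+}{+}\rangle_{AB}\}$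 be shared by two parties $A$ and $B$ holding one qubit each. Then: 1. $\mathcal S_{\rm PBR}$ does not admit $(1,1)$-LSAM, and it is not locally antidistinguishable. 2. $\mathcal S_{\rm PBR}$ admits $(2,3)$-LSAM. More precisely, the vectors $$|\xi_1\rangle=\tfrac1{\sqrt2}(|01\rangle+|10\rangle),\quad |\xi_2\rangle=\tfrac1{\sqrt2}(|0-\rangle+|1+\rangle),\quad |\xi_3\rangle=\tfrac1{\sqrt2}(|{+}1\rangle+|{-}0\rangle),\quad |\xi_4\rangle=\tfrac1{\sqrt2}(|{+}{-}\rangle+|{-}{+}\rangle)$$ define a projective measurement $\{|\xi_k\rangle\langle\xi_k|\}_{k=1}^4$, and if $A$ measures it on $A_1A_2$ and $B$ measures it on $B_1B_2$, then for every joint outcome $(k,l)$ there is a set of at least three of the twelve sequences of two different members of $\mathcal S_{\rm PBR}$ which that outcome excludes, so that announcing this set performs $(2,3)$-LSAM. 3. Antimarking is therefore strictly weaker than local antidistinguishability: every locally antidistinguishable ensemble of $N$ pure multipartite states admits $\bigl(n,\tfrac{(N-1)!}{(N-n)!}\bigr)$-LSAM for all $1\le n\le N$ (which is $(2,3)$-LSAM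 for $N=4$, $n=2$), whereas $\mathcal S_{\rm PBR}$ admits $(2,3)$-LSAM without being locally antidistinguishable. -/

import Mathlib

namespace AntiMarking

/-- Squared norm of a (possibly subnormalised) state vector given by its amplitudes
in the computational basis. -/
noncomputable def sqNorm {Z : Type} [Fintype Z] (v : Z → ℂ) : ℝ :=
  ∑ z, ‖v z‖ ^ 2

/-- The action of `1 ⊗ ⋯ ⊗ A ⊗ ⋯ ⊗ 1`, with `A` acting on the system of party `k`. Party `k`
holds the Hilbert space with orthonormal basis `H k`, so a joint vector is a function
on `∀ k, H k`. -/
def applyLocal {ι : Type} [DecidableEq ι] {H : ι → Type} [∀ k, Fintype (H k)]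
    (k : ι) (A : Matrix (H k) (H k) ℂ) (v : (∀ k, H k) → ℂ) : (∀ k, H k) → ℂ :=
  fun z => ∑ x, A (z k) x * v (Function.update z k x)

/-- Finite-round LOCC protocols among the parties `ι` that end with a classical announcement in
`O`. At each step either the protocol stops with an announcement, or one party performs a
generalised measurement with Kraus operators `A j`, `∑ j, (A j)ᴴ * A j = 1`, on its own system
and broadcasts the outcome `j`; the rest of the protocol may depend on `j`, hence on the whole
history. Keeping the local dimensions fixed does not restrict the attainable outcome statistics
(polar decomposition of the Kraus operators), and shared randomness is included: take the `A j`
to be multiples of the identity. -/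
inductive LOCCProtocol {ι : Type} (H : ι → Type) [∀ k, Fintype (H k)] [∀ k, DecidableEq (H k)]
    (O : Type) : Type
  | announce (o : O) : LOCCProtocol H O
  | measure (k : ι) (r : ℕ) (A : Fin r → Matrix (H k) (H k) ℂ)
      (complete : ∑ j, (A j).conjTranspose * A j = 1)
      (next : Fin r → LOCCProtocol H O) : LOCCProtocol H O

/-- The probability that the protocol announces `o` on the initial state vector `v`
(Born rule, summed over all measurement histories that lead to the announcement `o`). -/
noncomputable def LOCCProtocol.prob {ι : Type} [Fintype ι] [DecidableEq ι] {H : ι → Type}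
    [∀ k, Fintype (H k)] [∀ k, DecidableEq (H k)] {O : Type} [DecidableEq O] :
    LOCCProtocol H O → ((∀ k, H k) → ℂ) → O → ℝ
  | .announce o, v, o' => if o = o' then sqNorm v else 0
  | .measure k _ A _ next, v, o' => ∑ j, (next j).prob (applyLocal k (A j) v) o'

/-- Local (strong) antidistinguishability: some LOCC protocol announces an index such that
index `j` is never announced on the state `j`, and every index is announced with positive
probability on some state of the ensemble. -/
def LSAD {ι : Type} [Fintype ι] [DecidableEq ι] {H : ι → Type}
    [∀ k, Fintype (H k)] [∀ k, DecidableEq (H k)] {N : ℕ}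
    (ψ : Fin N → (∀ k, H k) → ℂ) : Prop :=
  ∃ P : LOCCProtocol H (Fin N),
    (∀ j, P.prob (ψ j) j = 0) ∧ ∀ j, 0 < ∑ i, P.prob (ψ i) j

/-- The state `ψ (s 0) ⊗ ⋯ ⊗ ψ (s (n-1))`, where party `k` holds its share of all `n` factors:
its local basis is `Fin n → H k`. -/
def seqState {ι : Type} {H : ι → Type} {N n : ℕ}
    (ψ : Fin N → (∀ k, H k) → ℂ) (s : Fin n → Fin N) : (∀ k, Fin n → H k) → ℂ :=
  fun z => ∏ t, ψ (s t) (fun k => z k t)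

/-- The protocol `P` performs `(n, m)` antimarking: whichever sequence `s` of `n` different
members of the ensemble is distributed, every announcement that occurs is a set of at least `m`
such sequences that does not contain `s`. -/
def Antimarks {ι : Type} [Fintype ι] [DecidableEq ι] {H : ι → Type}
    [∀ k, Fintype (H k)] [∀ k, DecidableEq (H k)] {N : ℕ}
    (ψ : Fin N → (∀ k, H k) → ℂ) (n m : ℕ)
    (P : LOCCProtocol (fun k => Fin n → H k) (Finset (Fin n ↪ Fin N))) : Prop :=
  ∀ (s : Fin n ↪ Fin N) (o : Finset (Fin n ↪ Fin N)),
    P.prob (seqState ψ s) o ≠ 0 → m ≤ o.card ∧ s ∉ o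

/-- The ensemble `ψ` admits `(n, m)` local state antimarking. -/
def LSAM {ι : Type} [Fintype ι] [DecidableEq ι] {H : ι → Type}
    [∀ k, Fintype (H k)] [∀ k, DecidableEq (H k)] {N : ℕ}
    (ψ : Fin N → (∀ k, H k) → ℂ) (n m : ℕ) : Prop :=
  ∃ P : LOCCProtocol (fun k => Fin n → H k) (Finset (Fin n ↪ Fin N)), Antimarks ψ n m P

/-- The qubit vector `|0⟩`. -/
def ket0 : Fin 2 → ℂ := ![1, 0]

/-- The qubit vector `|1⟩`. -/
def ket1 : Fin 2 → ℂ := ![0, 1]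

/-- The qubit vector `|+⟩`. -/
noncomputable def ketPlus : Fin 2 → ℂ := fun i => (ket0 i + ket1 i) / (√2 : ℝ)

/-- The qubit vector `|-⟩`. -/
noncomputable def ketMinus : Fin 2 → ℂ := fun i => (ket0 i - ket1 i) / (√2 : ℝ)

/-- The two-qubit product vector `a ⊗ b`. -/
def tensor (a b : Fin 2 → ℂ) : (Fin 2 → Fin 2) → ℂ := fun z => a (z 0) * b (z 1)

/-- The ensemble `|00⟩, |0+⟩, |+0⟩, |++⟩` of two parties (`0` is Alice, `1` is Bob) holding one
qubit each. -/
noncomputable def pbr : Fin 4 → (∀ _ : Fin 2, Fin 2) → ℂ :=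
  ![tensor ket0 ket0, tensor ket0 ketPlus, tensor ketPlus ket0, tensor ketPlus ketPlus]

/-- The four entangled two-qubit vectors `|ξ₁⟩, …, |ξ₄⟩`. -/
noncomputable def xi : Fin 4 → (Fin 2 → Fin 2) → ℂ :=
  ![fun z => (tensor ket0 ket1 z + tensor ket1 ket0 z) / (√2 : ℝ),
    fun z => (tensor ket0 ketMinus z + tensor ket1 ketPlus z) / (√2 : ℝ),
    fun z => (tensor ketPlus ket1 z + tensor ketMinus ket0 z) / (√2 : ℝ),
    fun z => (tensor ketPlus ketMinus z + tensor ketMinus ketPlus z) / (√2 : ℝ)]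

/-- The operator `|ξ_k⟩⟨ξ_k|` on the two qubits that one party holds. -/
noncomputable def xiProj (k : Fin 4) : Matrix (Fin 2 → Fin 2) (Fin 2 → Fin 2) ℂ :=
  Matrix.vecMulVec (xi k) (star (xi k))

end AntiMarking

open AntiMarking

/-! Negative part: each party's share is one of the two non-orthogonal vectors |0⟩ and |+⟩. Kraus
completeness writes an overlap as the sum of its overlaps after the outcomes, so some branch keeps
it non-zero. Along such branches some announcement has positive probability on all four states at
once (`LOCCProtocol.exists_common_announcement`), so nothing can be excluded. Positive part: with
two copies, each party again holds two qubits in one of the four PBR product states, and `xi k` is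
orthogonal to the k-th of them. Joint entangled measurements on each side therefore exclude one bit
pattern per party. General implication: antidistinguishing the first copy alone excludes every
string beginning with the announced letter. -/

namespace AntiMarking

open Matrix

/-! ### Overlaps and product vectors under LOCC. -/

section General

variable {ι : Type} [Fintype ι] [DecidableEq ι] {H : ι → Type}
  [∀ k, Fintype (H k)]

lemma sqNorm_nonneg {Z : Type} [Fintype Z] (v : Z → ℂ) : 0 ≤ sqNorm v :=
  Finset.sum_nonneg fun _ _ => by positivity

lemma sqNorm_pos {Z : Type} [Fintype Z] {v : Z → ℂ} (z : Z) (hz : v z ≠ 0) : 0 < sqNorm v :=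
  Finset.sum_pos' (fun _ _ => by positivity) ⟨z, Finset.mem_univ _, by positivity⟩

/-- The product vector `⨂ k, u k`. -/
def productState (u : ∀ k, H k → ℂ) : (∀ k, H k) → ℂ := fun z => ∏ k, u k (z k)

/-- Product form survives every local step, so overlaps can be tracked party by party. -/
lemma applyLocal_productState (k : ι) (A : Matrix (H k) (H k) ℂ) (u : ∀ k, H k → ℂ) :
    applyLocal k A (productState u) = productState (Function.update u k (A *ᵥ u k)) := by
  funext z
  have key (w : ∀ k, H k → ℂ) (y : ∀ k, H k) :
      productState w y = w k (y k) * ∏ i ∈ Finset.univ.erase k, w i (y i) :=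
    (Finset.mul_prod_erase _ (fun i => w i (y i)) (Finset.mem_univ k)).symm
  simp only [applyLocal]
  rw [key]
  simp only [key u, Function.update_self, Matrix.mulVec, dotProduct, Finset.sum_mul]
  refine Finset.sum_congr rfl fun x _ => ?_
  rw [mul_assoc]
  congr 2
  refine Finset.prod_congr rfl fun i hi => ?_
  have hik := Finset.ne_of_mem_erase hi
  rw [Function.update_of_ne hik, Function.update_of_ne hik]

/-- A measurement cannot make a non-zero overlap vanish in all of its branches. -/
lemma exists_overlap_ne_zero {Z : Type} [Fintype Z] [DecidableEq Z] {r : ℕ}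
    {A : Fin r → Matrix Z Z ℂ} (hA : ∑ j, (A j)ᴴ * A j = 1) {u v : Z → ℂ}
    (h : star u ⬝ᵥ v ≠ 0) : ∃ j, star (A j *ᵥ u) ⬝ᵥ (A j *ᵥ v) ≠ 0 := by
  by_contra! h0
  refine h ?_
  calc star u ⬝ᵥ v = star u ⬝ᵥ ((∑ j, (A j)ᴴ * A j) *ᵥ v) := by rw [hA, one_mulVec]
    _ = ∑ j, star (A j *ᵥ u) ⬝ᵥ (A j *ᵥ v) := by
      rw [sum_mulVec, dotProduct_sum]
      refine Finset.sum_congr rfl fun j _ => ?_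
      rw [star_mulVec, ← dotProduct_mulVec, mulVec_mulVec]
    _ = 0 := Finset.sum_eq_zero fun j _ => h0 j

variable [∀ k, DecidableEq (H k)]

lemma LOCCProtocol.prob_nonneg {O : Type} [DecidableEq O] (P : LOCCProtocol H O)
    (v : (∀ k, H k) → ℂ) (o : O) : 0 ≤ P.prob v o := by
  induction P generalizing v with
  | announce o' =>
    rw [LOCCProtocol.prob]
    split_ifs
    · exact sqNorm_nonneg v
    · exact le_rfl
  | measure k r A hA next ih =>
    rw [LOCCProtocol.prob]
    exact Finset.sum_nonneg fun j _ => ih j _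

/-- If each party holds one of two non-orthogonal vectors, then every LOCC protocol has an
announcement that occurs with positive probability on all the product vectors. -/
theorem LOCCProtocol.exists_common_announcement {O : Type} [DecidableEq O]
    (P : LOCCProtocol H O) (u : Bool → ∀ k, H k → ℂ)
    (hu : ∀ k, star (u false k) ⬝ᵥ u true k ≠ 0) :
    ∃ o, ∀ c : ι → Bool, 0 < P.prob (productState fun k => u (c k) k) o := by
  induction P generalizing u with
  | announce o =>
    refine ⟨o, fun c => ?_⟩
    rw [LOCCProtocol.prob, if_pos rfl]
    have hne (k) : ∃ x, u (c k) k x ≠ 0 := by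
      by_contra! h
      have h0 : u (c k) k = 0 := funext h
      cases hc : c k <;> rw [hc] at h0 <;> exact hu k (by simp [h0])
    choose x hx using hne
    exact sqNorm_pos x (Finset.prod_ne_zero_iff.mpr fun k _ => hx k)
  | measure k r A hA next ih =>
    -- In this branch party `k` keeps a non-zero overlap and the other parties are untouched, so the
    -- induction hypothesis applies.
    obtain ⟨j, hj⟩ := exists_overlap_ne_zero hA (hu k)
    obtain ⟨o, ho⟩ := ih j (fun b => Function.update (u b) k (A j *ᵥ u b k)) (by
      intro i
      rcases eq_or_ne i k with rfl | hi
      · simpa using hj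
      · simpa [Function.update_of_ne hi] using hu i)
    refine ⟨o, fun c => ?_⟩
    rw [LOCCProtocol.prob]
    refine Finset.sum_pos' (fun i _ => (next i).prob_nonneg _ _) ⟨j, Finset.mem_univ _, ?_⟩
    rw [applyLocal_productState]
    have hc : Function.update (fun i => u (c i) i) k (A j *ᵥ u (c k) k) =
        fun i => Function.update (u (c i)) k (A j *ᵥ u (c i) k) i := by
      funext i
      rcases eq_or_ne i k with rfl | hi
      · simp
      · simp [Function.update_of_ne hi]
    rw [hc]
    exact ho c

end General

/-! ### Running a protocol on the first copy only. -/

section Lift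

/-- The operator `A ⊗ 1 ⊗ ⋯ ⊗ 1` acting on the first of `m + 1` copies of a system. -/
def liftFirst {Z : Type} [DecidableEq Z] (m : ℕ) (A : Matrix Z Z ℂ) :
    Matrix (Fin (m + 1) → Z) (Fin (m + 1) → Z) ℂ :=
  (kroneckerMap (· * ·) A (1 : Matrix (Fin m → Z) (Fin m → Z) ℂ)).submatrix
    (Fin.consEquiv fun _ => Z).symm (Fin.consEquiv fun _ => Z).symm

lemma liftFirst_complete {Z : Type} [Fintype Z] [DecidableEq Z] (m : ℕ) {r : ℕ}
    {A : Fin r → Matrix Z Z ℂ} (hA : ∑ j, (A j)ᴴ * A j = 1) :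
    ∑ j, (liftFirst m (A j))ᴴ * liftFirst m (A j) = 1 := by
  have h (j : Fin r) : (liftFirst m (A j))ᴴ * liftFirst m (A j) =
      liftFirst m ((A j)ᴴ * A j) := by
    rw [liftFirst, conjTranspose_submatrix, submatrix_mul_equiv, conjTranspose_kronecker,
      ← mul_kronecker_mul, conjTranspose_one, one_mul, liftFirst]
  have hadd : ∑ j, liftFirst m ((A j)ᴴ * A j) = liftFirst m (∑ j, (A j)ᴴ * A j) := by
    ext x y
    simp [liftFirst, Matrix.sum_apply, Finset.sum_mul]
  rw [Finset.sum_congr rfl fun j _ => h j, hadd, hA, liftFirst, one_kronecker_one,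
    submatrix_one_equiv]

/-- The vector `v ⊗ w`, with `v` on the first copy and `w` on the remaining ones. -/
def consState {ι : Type} {H : ι → Type} {m : ℕ} (v : (∀ k, H k) → ℂ)
    (w : (∀ k, Fin m → H k) → ℂ) : (∀ k, Fin (m + 1) → H k) → ℂ :=
  fun z => v (fun k => z k 0) * w (fun k => Fin.tail (z k))

lemma seqState_succ {ι : Type} {H : ι → Type} {N m : ℕ} (ψ : Fin N → (∀ k, H k) → ℂ)
    (s : Fin (m + 1) → Fin N) :
    seqState ψ s = consState (ψ (s 0)) (seqState ψ (Fin.tail s)) := by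
  funext z
  simp [seqState, consState, Fin.prod_univ_succ, Fin.tail]

variable {ι : Type} {H : ι → Type} [∀ k, Fintype (H k)] [∀ k, DecidableEq (H k)]

/-- Run a protocol on the first of `m + 1` copies and post-process its announcement by `f`. -/
def LOCCProtocol.liftFirst {O O' : Type} (m : ℕ) (f : O → O') :
    LOCCProtocol H O → LOCCProtocol (fun k => Fin (m + 1) → H k) O'
  | .announce o => .announce (f o)
  | .measure k r A hA next =>
    .measure k r (fun j => AntiMarking.liftFirst m (A j)) (liftFirst_complete m hA)
      fun j => (next j).liftFirst m f

variable [DecidableEq ι]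

lemma applyLocal_liftFirst {m : ℕ} (k : ι) (A : Matrix (H k) (H k) ℂ)
    (v : (∀ k, H k) → ℂ) (w : (∀ k, Fin m → H k) → ℂ) :
    applyLocal (H := fun k => Fin (m + 1) → H k) k (liftFirst m A) (consState v w) =
      consState (applyLocal k A v) w := by
  funext z
  have h0 (a : H k) (b : Fin m → H k) :
      (fun i => Function.update z k (Fin.cons a b : Fin (m + 1) → H k) i 0) =
        Function.update (fun i => z i 0) k a := by
    funext i
    rcases eq_or_ne i k with rfl | hi
    · simp
    · simp [Function.update_of_ne hi]
  have h1 (a : H k) (b : Fin m → H k) :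
      (fun i => Fin.tail (Function.update z k (Fin.cons a b : Fin (m + 1) → H k) i)) =
        Function.update (fun i => Fin.tail (z i)) k b := by
    funext i
    rcases eq_or_ne i k with rfl | hi
    · simp
    · simp [Function.update_of_ne hi]
  have hz : Function.update (fun i => Fin.tail (z i)) k (Fin.tail (z k)) =
      fun i => Fin.tail (z i) := Function.update_eq_self k fun i => Fin.tail (z i)
  simp only [applyLocal]
  rw [← (Fin.consEquiv fun _ => H k).sum_comp, Fintype.sum_prod_type]
  simp only [consState, applyLocal, Finset.sum_mul]
  refine Finset.sum_congr rfl fun a _ => ?_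
  -- The identity factor on the remaining copies kills every other tail.
  rw [Finset.sum_eq_single (Fin.tail (z k))]
  · have := h0 a (Fin.tail (z k))
    have := h1 a (Fin.tail (z k))
    simp_all [liftFirst, Fin.consEquiv, mul_assoc]
  · intro b _ hb
    have : Fin.tail (z k) ≠ b := fun h => hb h.symm
    simp [liftFirst, Fin.consEquiv, this]
  · simp

/-- An announcement of the lifted protocol that occurs on `v ⊗ w` comes from an announcement of
the original protocol that occurs on `v`. -/
lemma LOCCProtocol.exists_of_prob_liftFirst_ne_zero [Fintype ι] {O O' : Type} [DecidableEq O]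
    [DecidableEq O'] {m : ℕ} (f : O → O') (P : LOCCProtocol H O) (v : (∀ k, H k) → ℂ)
    (w : (∀ k, Fin m → H k) → ℂ) (o' : O')
    (h : (P.liftFirst m f).prob (consState v w) o' ≠ 0) :
    ∃ o, f o = o' ∧ P.prob v o ≠ 0 := by
  induction P generalizing v with
  | announce o =>
    rw [LOCCProtocol.liftFirst, LOCCProtocol.prob] at h
    split_ifs at h with ho
    · refine ⟨o, ho, ?_⟩
      rw [LOCCProtocol.prob, if_pos rfl]
      obtain ⟨z, -, hz⟩ := Finset.exists_ne_zero_of_sum_ne_zero h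
      refine (sqNorm_pos (fun k => z k 0) fun h0 => hz ?_).ne'
      simp [consState, h0]
    · exact absurd rfl h
  | measure k r A hA next ih =>
    rw [LOCCProtocol.liftFirst, LOCCProtocol.prob] at h
    obtain ⟨j, -, hj⟩ := Finset.exists_ne_zero_of_sum_ne_zero h
    rw [applyLocal_liftFirst] at hj
    obtain ⟨o, ho, hP⟩ := ih j _ hj
    refine ⟨o, ho, ?_⟩
    rw [LOCCProtocol.prob]
    refine (Finset.sum_pos' (fun i _ => (next i).prob_nonneg _ _) ⟨j, Finset.mem_univ _, ?_⟩).ne'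
    exact lt_of_le_of_ne ((next j).prob_nonneg _ _) hP.symm

/-- At least `N! / (N - m)!` injective strings of length `m + 1` over `N + 1` letters start
with a given letter. -/
lemma le_card_embedding_head_eq {N m : ℕ} (hm : m ≤ N) (j : Fin (N + 1)) :
    N.factorial / (N - m).factorial ≤
      (Finset.univ.filter fun s : Fin (m + 1) ↪ Fin (N + 1) => s 0 = j).card := by
  let g : (Fin m ↪ Fin N) → (Fin (m + 1) ↪ Fin (N + 1)) := fun t =>
    ⟨Fin.cons j (fun i => j.succAbove (t i)), by
      rw [Fin.cons_injective_iff]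
      refine ⟨?_, (Fin.succAbove_right_injective).comp t.injective⟩
      rintro ⟨i, hi⟩
      exact Fin.succAbove_ne _ _ hi⟩
  have hg : Function.Injective g := by
    intro t t' h
    ext i : 1
    have := DFunLike.congr_fun h i.succ
    simpa [g] using this
  calc N.factorial / (N - m).factorial = (Finset.univ : Finset (Fin m ↪ Fin N)).card := by
        rw [Finset.card_univ, Fintype.card_embedding_eq, Fintype.card_fin, Fintype.card_fin,
          Nat.descFactorial_eq_div hm]
    _ = (Finset.univ.image g).card := (Finset.card_image_of_injective _ hg).symm
    _ ≤ _ := by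
        refine Finset.card_le_card fun s hs => ?_
        obtain ⟨t, -, rfl⟩ := Finset.mem_image.mp hs
        simp [g]

theorem LSAD.lsam [Fintype ι] {N : ℕ} {ψ : Fin N → (∀ k, H k) → ℂ} (h : LSAD ψ)
    {n : ℕ} (hn : 1 ≤ n) (hnN : n ≤ N) :
    LSAM ψ n ((N - 1).factorial / (N - n).factorial) := by
  obtain ⟨P, hP, -⟩ := h
  obtain ⟨m, rfl⟩ := Nat.exists_eq_add_of_le' hn
  obtain ⟨M, rfl⟩ := Nat.exists_eq_add_of_le' (hn.trans hnN)
  -- Were `s` in the announced set, `P` would have announced `s 0` with non-zero probability on `ψ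
  -- (s 0)`.
  refine ⟨P.liftFirst m fun j => Finset.univ.filter fun s => s 0 = j, fun s o ho => ?_⟩
  rw [seqState_succ] at ho
  obtain ⟨j, rfl, hj⟩ := P.exists_of_prob_liftFirst_ne_zero _ _ _ _ ho
  refine ⟨?_, fun hs => hj ?_⟩
  · have := le_card_embedding_head_eq (by omega : m ≤ M) j
    simpa using this
  · rw [Finset.mem_filter] at hs
    rw [← hs.2]
    exact hP _

end Lift

/-! ### The PBR ensemble. -/

section PBR

/-- The two qubit vectors `|0⟩` and `|+⟩` of which the ensemble `pbr` is built. -/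
noncomputable def pbrKet : Bool → Fin 2 → ℂ
  | false => ket0
  | true => ketPlus

/-- The factor of the state `pbr i` that party `k` holds. -/
def pbrBit (i : Fin 4) (k : Fin 2) : Bool :=
  ![![false, false], ![false, true], ![true, false], ![true, true]] i k

lemma pbr_eq_productState (i : Fin 4) :
    pbr i = productState fun k => pbrKet (pbrBit i k) := by
  funext z
  fin_cases i <;> simp [pbr, productState, tensor, pbrBit, pbrKet]

lemma sqrt_two_ne_zero : ((√2 : ℝ) : ℂ) ≠ 0 := by simp

lemma sqrt_two_sq : ((√2 : ℝ) : ℂ) ^ 2 = 2 := by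
  rw [← Complex.ofReal_pow, Real.sq_sqrt zero_le_two, Complex.ofReal_ofNat]

lemma pbrKet_overlap : star (pbrKet false) ⬝ᵥ pbrKet true ≠ 0 := by
  simp [pbrKet, ket0, ket1, ketPlus, dotProduct]

theorem not_lsad_pbr : ¬ LSAD pbr := by
  rintro ⟨P, hP, -⟩
  obtain ⟨j, hj⟩ := P.exists_common_announcement (fun b _ => pbrKet b) fun _ => pbrKet_overlap
  have := hj (pbrBit j)
  rw [← pbr_eq_productState, hP j] at this
  exact lt_irrefl _ this

theorem not_lsam_pbr_one_one : ¬ LSAM pbr 1 1 := by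
  rintro ⟨P, hP⟩
  obtain ⟨o, ho⟩ := P.exists_common_announcement (fun b _ x => pbrKet b (x 0)) fun _ => by
    have := pbrKet_overlap
    rwa [dotProduct, ← (Equiv.funUnique (Fin 1) (Fin 2)).sum_comp] at this
  -- The common announcement `o` must be non-empty yet avoid every string.
  have key (s : Fin 1 ↪ Fin 4) : 1 ≤ o.card ∧ s ∉ o := by
    refine hP s o ?_
    have := (ho (pbrBit (s 0))).ne'
    convert this using 2
    funext z
    simp [seqState, productState, pbr_eq_productState]
  obtain ⟨s, hs⟩ := Finset.card_pos.mp (key ⟨fun _ => 0, fun _ _ _ => Subsingleton.elim _ _⟩).1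
  exact (key s).2 hs

lemma xi_eq (k : Fin 4) (z : Fin 2 → Fin 2) :
    xi k z = ![![![0, 1 / (√2 : ℝ)], ![1 / (√2 : ℝ), 0]], ![![1 / 2, -1 / 2], ![1 / 2, 1 / 2]],
      ![![1 / 2, 1 / 2], ![-1 / 2, 1 / 2]], ![![1 / (√2 : ℝ), 0], ![0, -1 / (√2 : ℝ)]]]
        k (z 0) (z 1) := by
  have h0 := sqrt_two_ne_zero
  have h2 := sqrt_two_sq
  rcases Fin.exists_fin_two.mp ⟨z 0, rfl⟩ with ha | ha <;>
  rcases Fin.exists_fin_two.mp ⟨z 1, rfl⟩ with hb | hb <;>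
  fin_cases k <;>
  simp [xi, tensor, ket0, ket1, ketPlus, ketMinus, ha, hb] <;> grind

lemma sum_xiProj : ∑ k, (xiProj k)ᴴ * xiProj k = 1 := by
  have hn (k : Fin 4) : (xiProj k)ᴴ * xiProj k = xiProj k := by
    have h1 : star (xi k) ⬝ᵥ xi k = 1 := by
      rw [dotProduct, ← (finTwoArrowEquiv (Fin 2)).symm.sum_comp, Fintype.sum_prod_type]
      have h2 := sqrt_two_sq
      have h0 := sqrt_two_ne_zero
      fin_cases k <;> simp [xi_eq, finTwoArrowEquiv] <;> grind
    rw [xiProj, conjTranspose_vecMulVec, star_star, vecMulVec_mul_vecMulVec, h1, one_smul]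
  -- What remains is the resolution of the identity by the four projectors, checked entrywise.
  rw [Finset.sum_congr rfl fun k _ => hn k]
  ext x y
  have h2 := sqrt_two_sq
  have h0 := sqrt_two_ne_zero
  obtain ⟨⟨a, b⟩, rfl⟩ := (finTwoArrowEquiv (Fin 2)).symm.surjective x
  obtain ⟨⟨c, d⟩, rfl⟩ := (finTwoArrowEquiv (Fin 2)).symm.surjective y
  simp only [one_apply, Equiv.apply_eq_iff_eq, Matrix.sum_apply]
  fin_cases a <;> fin_cases b <;> fin_cases c <;> fin_cases d <;>
  simp [xiProj, vecMulVec_apply, xi_eq, finTwoArrowEquiv, Fin.sum_univ_four] <;> grind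

lemma xi_dotProduct_pbr (k : Fin 4) : star (xi k) ⬝ᵥ pbr k = 0 := by
  rw [dotProduct, ← (finTwoArrowEquiv (Fin 2)).symm.sum_comp, Fintype.sum_prod_type]
  have h2 := sqrt_two_sq
  have h0 := sqrt_two_ne_zero
  fin_cases k <;>
  simp [xi_eq, finTwoArrowEquiv, pbr, tensor, ket0, ket1, ketPlus] <;> grind

/-- The sequences of two different members of `pbr` that are excluded by the joint outcome
`(k, l)`: Alice's vectors are orthogonal to `xi k`, or Bob's vectors are orthogonal to `xi l`. -/
noncomputable def excluded (k l : Fin 4) : Finset (Fin 2 ↪ Fin 4) :=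
  Finset.univ.filter fun s =>
    (∀ t, pbrBit (s t) 0 = pbrBit k t) ∨ ∀ t, pbrBit (s t) 1 = pbrBit l t

/-- Each party's condition selects four ordered pairs of states and the two share exactly one,
giving seven; at most three of these repeat a state. The count is made on pairs so that `decide` can
evaluate it. -/
lemma three_le_card_excluded (k l : Fin 4) : 3 ≤ (excluded k l).card := by
  have hpairs : 3 ≤ (Finset.univ.filter fun p : Fin 4 × Fin 4 => p.1 ≠ p.2 ∧
      ((pbrBit p.1 0 = pbrBit k 0 ∧ pbrBit p.2 0 = pbrBit k 1) ∨
        (pbrBit p.1 1 = pbrBit l 0 ∧ pbrBit p.2 1 = pbrBit l 1))).card := by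
    revert k l
    decide
  refine hpairs.trans ((Finset.card_le_card fun p hp => ?_).trans
    (Finset.card_image_le (s := excluded k l) (f := fun s => (s 0, s 1))))
  obtain ⟨hne, hp⟩ := (Finset.mem_filter.mp hp).2
  refine Finset.mem_image.mpr ⟨⟨![p.1, p.2], ?_⟩, ?_, rfl⟩
  · intro i j
    fin_cases i <;> fin_cases j <;> simp [hne, hne.symm]
  · simp only [excluded, Fin.forall_fin_two, Finset.mem_filter_univ]
    exact hp

/-- Regroups the factors by party instead of by copy. -/
lemma seqState_pbr (s : Fin 2 → Fin 4) :
    seqState pbr s = productState (H := fun _ => Fin 2 → Fin 2) fun k =>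
      productState fun t => pbrKet (pbrBit (s t) k) := by
  funext z
  simp only [seqState, pbr_eq_productState, productState]
  exact Finset.prod_comm

lemma xiProj_mulVec_eq_zero {k : Fin 4} {c : Fin 2 → Bool} (hc : ∀ t, c t = pbrBit k t) :
    xiProj k *ᵥ productState (fun t => pbrKet (c t)) = 0 := by
  obtain rfl : c = pbrBit k := funext hc
  -- Here `pbr k` is read with its two tensor factors as one party's two copies, not as two parties.
  rw [xiProj, vecMulVec_mulVec, ← pbr_eq_productState, xi_dotProduct_pbr]
  simp

theorem antimarks_xiProj : Antimarks pbr 2 3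
    (.measure 0 4 xiProj sum_xiProj fun k => .measure 1 4 xiProj sum_xiProj fun l =>
      .announce (excluded k l)) := by
  intro s o ho
  simp only [LOCCProtocol.prob] at ho
  obtain ⟨k, -, hk⟩ := Finset.exists_ne_zero_of_sum_ne_zero ho
  obtain ⟨l, -, hl⟩ := Finset.exists_ne_zero_of_sum_ne_zero hk
  split_ifs at hl with h
  · subst h
    refine ⟨three_le_card_excluded k l, fun hs => hl ?_⟩
    rw [seqState_pbr, applyLocal_productState, applyLocal_productState]
    refine Finset.sum_eq_zero fun z _ => ?_
    -- Whichever party matches its outcome's pattern contributes a zero factor.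
    rcases (Finset.mem_filter.mp hs).2 with h | h
    · simp [productState, Fin.prod_univ_two, xiProj_mulVec_eq_zero h]
    · simp [productState, Fin.prod_univ_two, xiProj_mulVec_eq_zero h]
  · exact absurd rfl hl

end PBR

end AntiMarking

theorem mainTheorem7 :
    -- the ensemble is not `(1,1)`-antimarkable and not locally antidistinguishable
    ¬ LSAM pbr 1 1 ∧ ¬ LSAD pbr ∧
    -- it is `(2,3)`-antimarkable
    LSAM pbr 2 3 ∧
    -- namely by both parties measuring their two qubits in the basis `ξ`
    (∃ (h : ∑ k, (xiProj k).conjTranspose * xiProj k = 1)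
        (E : Fin 4 → Fin 4 → Finset (Fin 2 ↪ Fin 4)),
      (∀ k l, 3 ≤ (E k l).card) ∧
      Antimarks pbr 2 3
        (.measure 0 4 xiProj h fun k => .measure 1 4 xiProj h fun l => .announce (E k l))) ∧
    -- while local antidistinguishability always implies local antimarkability
    (∀ (ι : Type) [Fintype ι] [DecidableEq ι] (H : ι → Type) [∀ k, Fintype (H k)]
        [∀ k, DecidableEq (H k)] (N : ℕ) (ψ : Fin N → (∀ k, H k) → ℂ),
      (∀ i, sqNorm (ψ i) = 1) → LSAD ψ →
        ∀ n, 1 ≤ n → n ≤ N → LSAM ψ n ((N - 1).factorial / (N - n).factorial)) := by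
  exact ⟨not_lsam_pbr_one_one, not_lsad_pbr, ⟨_, antimarks_xiProj⟩,
    ⟨sum_xiProj, excluded, three_le_card_excluded, antimarks_xiProj⟩,
    fun _ _ _ _ _ _ _ _ _ h _ hn hnN => h.lsam hn hnN⟩
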